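/- There is an absolute constant $C > 0$ such that for every integer $n \ge 1$ there is a set $A$ of non-negative integers with $|A| = n$ for which the cosine polynomial \[ f_A(x) := \sum_{a \in A} \cos(ax) \] has at most $C\,(n \log n)^{2/3}$ zeros in the interval $[0,2\pi]$, counted with multiplicity. -/

import Mathlib

noncomputable section

/-- The cosine polynomial `f_A(x) = ∑_{a ∈ A} cos (a x)` of a finite set `A` of
non-negative integers. -/
def cosPoly (A : Finset ℕ) (x : ℝ) : ℝ :=
  ∑ a ∈ A, Real.cos (a * x)

/-- The zeros of `f` in the interval `[0, 2π]`. -/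
def zeroSet (f : ℝ → ℝ) : Set ℝ :=
  {x | x ∈ Set.Icc 0 (2 * Real.pi) ∧ f x = 0}

/-- The number of zeros of a real analytic function `f` in `[0, 2π]`, each zero being counted
with its multiplicity (its order of vanishing). It is the supremum of the partial counts over
finite sets of zeros, so that it is `⊤` if there are infinitely many zeros. -/
def zeroCount (f : ℝ → ℝ) : ℕ∞ :=
  ⨆ (S : Finset ℝ) (_ : (S : Set ℝ) ⊆ zeroSet f), ∑ x ∈ S, analyticOrderAt f x

end

/-! Take `A = S ∪ [m + 1, N)` with `S ⊆ [0, m)` to be chosen at random. The long block is a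
Dirichlet kernel, so `2 sin (x / 2) f_A = F := sin (M x) + T`, where `M = N - 1 / 2` and `T`
(`lowFrequencyPart`) has degree `O(m)` and depends on `S` but not on `N`.

Cut `[0, 2π)` into `2 L` cells of length `π / L < π / M`. The operator `u ↦ u'' + M² u` kills `sin
(M x)` and turns `F` into a trigonometric polynomial of degree `O(m)`. By a Sturm-type argument `F`
has at most two more zeros in a cell than its image (`exists_finset_sum_order_le_add_two`). Hence
`F` has at most `O(m)` zeros plus two per cell that contains a zero. Such a cell contains a point
with `|T| ≤ 1`: either this already holds at its left endpoint, or `T² = 1` somewhere in the cell,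
which happens in only `O(m)` cells (`sum_order_le_of_grid`).

By Littlewood–Offord, a random `S` gives `|T(x)| ≤ 1` with probability `O(1 / (sin (x / 2) √m))`.
Summed over the grid this is a harmonic sum, so some `S` has `O(L log L / √m)` bad grid points. With
`L ≍ n` the total is `O(m + n log n / √m)`, balanced at `m ≍ (n log n)^(2/3)`. -/

/-! ### Anti-concentration of subset sums. -/

/-- A non-asymptotic upper bound for the central binomial coefficient. -/
theorem centralBinom_sq_mul_le (t : ℕ) : (Nat.centralBinom t) ^ 2 * (2 * t + 1) ≤ 16 ^ t := by
  induction t with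
  | zero => simp
  | succ t ih =>
    have h := Nat.succ_mul_centralBinom_succ t
    have h2 : (t + 1) ^ 2 * ((Nat.centralBinom (t + 1)) ^ 2 * (2 * (t + 1) + 1))
        ≤ (t + 1) ^ 2 * 16 ^ (t + 1) := by
      calc (t + 1) ^ 2 * ((Nat.centralBinom (t + 1)) ^ 2 * (2 * (t + 1) + 1))
          = ((t + 1) * Nat.centralBinom (t + 1)) ^ 2 * (2 * t + 3) := by ring
        _ = (2 * (2 * t + 1) * Nat.centralBinom t) ^ 2 * (2 * t + 3) := by rw [h]
        _ = ((Nat.centralBinom t) ^ 2 * (2 * t + 1)) * (4 * (2 * t + 1) * (2 * t + 3)) := by ring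
        _ ≤ 16 ^ t * (16 * (t + 1) ^ 2) := by
            apply Nat.mul_le_mul ih
            nlinarith
        _ = (t + 1) ^ 2 * 16 ^ (t + 1) := by ring
    exact Nat.le_of_mul_le_mul_left h2 (by positivity)

theorem choose_half_sq_mul_le (k : ℕ) : (k.choose (k / 2)) ^ 2 * k ≤ 4 ^ k := by
  obtain ⟨t, rfl | rfl⟩ := Nat.even_or_odd' k
  · have h := centralBinom_sq_mul_le t
    rw [Nat.centralBinom] at h
    rw [Nat.mul_div_cancel_left t two_pos, pow_mul]
    norm_num
    nlinarith
  · have h := centralBinom_sq_mul_le (t + 1)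
    have h2 : Nat.centralBinom (t + 1) = 2 * (2 * t + 1).choose t := by
      rw [Nat.centralBinom, show 2 * (t + 1) = 2 * t + 1 + 1 by ring, Nat.choose_succ_succ,
        Nat.choose_symm_half]
      ring
    have h3 : (2 * t + 1) / 2 = t := by omega
    rw [h2, mul_pow, pow_succ 16] at h
    rw [h3, pow_succ 4, pow_mul]
    norm_num at h ⊢
    nlinarith

theorem choose_half_le (k : ℕ) (hk : 0 < k) :
    ((k.choose (k / 2) : ℕ) : ℝ) ≤ 2 ^ k / Real.sqrt k := by
  have h : (((k.choose (k / 2) : ℕ) : ℝ)) ^ 2 * k ≤ 4 ^ k := by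
    exact_mod_cast choose_half_sq_mul_le k
  have hk' : (0 : ℝ) < k := by exact_mod_cast hk
  rw [le_div_iff₀ (Real.sqrt_pos.mpr hk')]
  refine (sq_le_sq₀ (by positivity) (by positivity)).mp ?_
  rw [mul_pow, Real.sq_sqrt hk'.le, ← pow_mul, mul_comm k 2, pow_mul]
  norm_num
  exact h

/-- **The Littlewood–Offord problem in dimension one** (Erdős): if `|v i| ≥ r` for `i ∈ J`, at
most `(|J| choose ⌊|J|/2⌋)` subset sums lie in a given half-open interval of length `r`. -/
theorem card_subsetSum_mem_Ico_le {ι : Type*} [DecidableEq ι] (J : Finset ι) (v : ι → ℝ) {r : ℝ}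
    (hv : ∀ i ∈ J, r ≤ |v i|) (y : ℝ) :
    (J.powerset.filter fun S => ∑ i ∈ S, v i ∈ Set.Ico y (y + r)).card
      ≤ J.card.choose (J.card / 2) := by
  classical
  set N := J.filter fun i => v i < 0 with hN
  -- Swapping membership on the negative `v i` makes every weight `|v i|`, at the cost of a constant
  -- shift of the sums.
  set φ : Finset ι → Finset J := fun S => (symmDiff S N).subtype (· ∈ J) with hφ
  set 𝒜 := J.powerset.filter fun S => ∑ i ∈ S, v i ∈ Set.Ico y (y + r) with h𝒜
  have mem_φ : ∀ S (i : J), i ∈ φ S ↔ ((i : ι) ∈ S ∧ ¬ v i < 0 ∨ v i < 0 ∧ (i : ι) ∉ S) := by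
    intro S i
    simp [hφ, hN, Finset.mem_symmDiff]
  have key : ∀ S ⊆ J, ∑ i ∈ S, v i = ∑ i ∈ φ S, |v i| + ∑ i ∈ N, v i := by
    intro S hS
    have e1 : ∑ i ∈ S, v i = ∑ i : J, if (i : ι) ∈ S then v i else 0 := by
      rw [Finset.sum_coe_sort J (fun i => if i ∈ S then v i else 0), ← Finset.sum_filter]
      congr 1
      ext i; simp; exact fun h => hS h
    have e2 : ∑ i ∈ N, v i = ∑ i : J, if v i < 0 then v i else 0 := by
      rw [Finset.sum_coe_sort J (fun i => if v i < 0 then v i else 0), ← Finset.sum_filter]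
    have e3 : ∑ i ∈ φ S, |v i| = ∑ i : J, if i ∈ φ S then |v i| else 0 := by
      rw [← Finset.sum_filter, Finset.filter_mem_eq_inter, Finset.univ_inter]
    rw [e1, e2, e3, ← Finset.sum_add_distrib]
    refine Finset.sum_congr rfl fun i _ => ?_
    simp only [mem_φ]
    by_cases h1 : (i : ι) ∈ S <;> by_cases h2 : v i < 0
    · simp [h1, h2]
    · simp [h1, h2, abs_of_nonneg (not_lt.mp h2)]
    · simp [h1, h2, abs_of_neg h2]
    · simp [h1, h2]
  have hinj : Set.InjOn φ 𝒜 := by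
    intro S hS S' hS' h
    simp only [h𝒜, Finset.coe_filter, Finset.mem_powerset, Set.mem_ofPred_eq] at hS hS'
    ext i
    by_cases hi : i ∈ J
    · have := mem_φ S ⟨i, hi⟩
      rw [h, mem_φ] at this
      simp only at this
      tauto
    · exact ⟨fun h => absurd (hS.1 h) hi, fun h => absurd (hS'.1 h) hi⟩
  -- A strict inclusion would raise the sum by at least `r`, which a half-open interval of length
  -- `r` does not allow; Sperner's theorem then applies.
  have hanti : IsAntichain (· ⊆ ·) (SetLike.coe (𝒜.image φ)) := by
    rintro _ hB _ hB' hne hsub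
    simp only [SetLike.mem_coe, Finset.mem_image] at hB hB'
    obtain ⟨S, hS, rfl⟩ := hB
    obtain ⟨S', hS', rfl⟩ := hB'
    simp only [h𝒜, Finset.mem_filter, Finset.mem_powerset] at hS hS'
    have hss : φ S ⊂ φ S' := hsub.ssubset_of_ne hne
    obtain ⟨i, hi, hi'⟩ := Finset.exists_of_ssubset hss
    have h1 : ∑ j ∈ φ S, |v j| + |v i| ≤ ∑ j ∈ φ S', |v j| := by
      rw [add_comm, ← Finset.sum_insert (f := fun j : J => |v j|) hi']
      exact Finset.sum_le_sum_of_subset_of_nonneg (Finset.insert_subset hi hsub)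
        fun _ _ _ => abs_nonneg _
    have h2 := hv i i.2
    have h3 := key S hS.1
    have h4 := key S' hS'.1
    have h5 := hS.2.1
    have h6 := hS'.2.2
    linarith
  have := hanti.sperner
  rwa [Finset.card_image_of_injOn hinj, Fintype.card_coe] at this

/-- Condition on `S \ J`: it only translates the interval for the remaining sum over `S ∩ J`. -/
theorem card_subsetSum_mem_Ico_le_mul {ι : Type*} [DecidableEq ι] {J I : Finset ι}
    (v : ι → ℝ) {r : ℝ} (hv : ∀ i ∈ J, r ≤ |v i|) (y : ℝ) :
    (I.powerset.filter fun S => ∑ i ∈ S, v i ∈ Set.Ico y (y + r)).card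
      ≤ 2 ^ (I \ J).card * J.card.choose (J.card / 2) := by
  classical
  rw [← Finset.card_powerset, mul_comm]
  refine Finset.card_le_mul_card_image_of_maps_to (f := fun S => S \ J) ?_ _ ?_
  · intro S hS
    simp only [Finset.mem_filter, Finset.mem_powerset] at hS ⊢
    exact Finset.sdiff_subset_sdiff hS.1 subset_rfl
  · intro B hB
    refine le_trans ?_ (card_subsetSum_mem_Ico_le J v hv (y - ∑ i ∈ B, v i))
    refine Finset.card_le_card_of_injOn (fun S => S ∩ J) ?_ ?_
    · intro S hS
      simp only [Finset.coe_filter, Finset.mem_filter, Finset.mem_powerset, Set.mem_ofPred_eq] at hS ⊢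
      obtain ⟨⟨hSI, h1, h2⟩, h3⟩ := hS
      have := Finset.sum_inter_add_sum_sdiff S J v
      rw [h3] at this
      exact ⟨Finset.inter_subset_right, by linarith, by linarith⟩
    · intro S hS S' hS' h
      simp only [Finset.coe_filter, Finset.mem_filter, Finset.mem_powerset, Set.mem_ofPred_eq] at hS hS' h
      rw [← Finset.sdiff_union_inter S J, ← Finset.sdiff_union_inter S' J, hS.2, hS'.2, h]

/-- Cover the interval by `⌊l / r⌋ + 1` half-open intervals of length `r`. -/
theorem card_subsetSum_mem_Icc_le {ι : Type*} [DecidableEq ι] {J I : Finset ι}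
    (hJI : J ⊆ I) (hJ : 0 < J.card) (v : ι → ℝ) {r : ℝ} (hr : 0 < r) (hv : ∀ i ∈ J, r ≤ |v i|)
    (y : ℝ) {l : ℝ} (hl : 0 ≤ l) :
    ((I.powerset.filter fun S => ∑ i ∈ S, v i ∈ Set.Icc y (y + l)).card : ℝ)
      ≤ (l / r + 1) * (2 ^ I.card / Real.sqrt J.card) := by
  classical
  set K := ⌊l / r⌋₊ + 1 with hK
  have hsub : (I.powerset.filter fun S => ∑ i ∈ S, v i ∈ Set.Icc y (y + l)) ⊆
      (Finset.range K).biUnion fun k => I.powerset.filter fun S =>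
        ∑ i ∈ S, v i ∈ Set.Ico (y + k * r) (y + k * r + r) := by
    intro S hS
    simp only [Finset.mem_filter, Finset.mem_biUnion, Finset.mem_range] at hS ⊢
    obtain ⟨hSI, h1, h2⟩ := hS
    set s := ∑ i ∈ S, v i
    have hs : 0 ≤ (s - y) / r := div_nonneg (by linarith) hr.le
    refine ⟨⌊(s - y) / r⌋₊, ?_, hSI, ?_, ?_⟩
    · rw [hK, Nat.lt_succ_iff]
      exact Nat.floor_le_floor (div_le_div_of_nonneg_right (by linarith) hr.le)
    · have := Nat.floor_le hs
      rw [le_div_iff₀ hr] at this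
      linarith
    · have := Nat.lt_floor_add_one ((s - y) / r)
      rw [div_lt_iff₀ hr] at this
      linarith
  have h1 := (Finset.card_le_card hsub).trans (Finset.card_biUnion_le_card_mul _ _ _
    fun k _ => card_subsetSum_mem_Ico_le_mul v hv (y + k * r))
  rw [Finset.card_range] at h1
  have h2 : ((I.powerset.filter fun S => ∑ i ∈ S, v i ∈ Set.Icc y (y + l)).card : ℝ) ≤
      K * (2 ^ (I \ J).card * (J.card.choose (J.card / 2) : ℕ)) := by exact_mod_cast h1
  refine h2.trans ?_
  have h3 := choose_half_le J.card hJ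
  have h4 : (K : ℝ) ≤ l / r + 1 := by
    rw [hK]; push_cast
    have := Nat.floor_le (div_nonneg hl hr.le)
    linarith
  have h5 : (2 : ℝ) ^ I.card = 2 ^ (I \ J).card * 2 ^ J.card := by
    rw [← pow_add, Finset.card_sdiff_add_card_eq_card hJI]
  rw [h5, mul_div_assoc]
  gcongr

/-! ### Small ball estimate for cosine sums. -/

/-- Among the numbers `cos (a x)`, `a < m`, at least a quarter are at least `1 / 2` in absolute
value, because `cos (a x)` and `cos (2 a x)` cannot both be small. -/
theorem le_four_mul_card_half_le_abs_cos (m : ℕ) (x : ℝ) :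
    m ≤ 4 * ((Finset.range m).filter fun a => 1 / 2 ≤ |Real.cos ((a : ℕ) * x)|).card := by
  classical
  set J := (Finset.range m).filter fun a => 1 / 2 ≤ |Real.cos ((a : ℕ) * x)| with hJ
  -- For `a < (m + 1) / 2` the double `2 a` is still below `m`, so `a` or `2 a` lies in `J`.
  have hsub : Finset.range ((m + 1) / 2) ⊆ J ∪ J.image (· / 2) := by
    intro a ha
    rw [Finset.mem_range] at ha
    by_cases h : 1 / 2 ≤ |Real.cos (a * x)|
    · exact Finset.mem_union_left _ (by
        rw [hJ, Finset.mem_filter, Finset.mem_range]; exact ⟨by omega, h⟩)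
    · refine Finset.mem_union_right _ (Finset.mem_image.mpr ⟨2 * a, ?_, by simp⟩)
      rw [hJ, Finset.mem_filter, Finset.mem_range]
      refine ⟨by omega, ?_⟩
      push_cast
      rw [mul_assoc, Real.cos_two_mul]
      rw [not_le] at h
      have h1 := abs_lt.mp h
      have : Real.cos (a * x) ^ 2 < 1 / 4 := by nlinarith
      rw [le_abs]; right; linarith
  have h1 := (Finset.card_le_card hsub).trans (Finset.card_union_le _ _)
  have h2 : (J.image (· / 2)).card ≤ J.card := Finset.card_image_le
  rw [Finset.card_range] at h1
  omega

/-- Small ball estimate for random cosine sums. -/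
theorem card_cosSum_mem_Icc_le {m : ℕ} (hm : 0 < m) (x y : ℝ) {l : ℝ} (hl : 1 ≤ l) :
    (((Finset.range m).powerset.filter fun S =>
        ∑ a ∈ S, Real.cos ((a : ℕ) * x) ∈ Set.Icc y (y + l)).card : ℝ)
      ≤ 6 * l * 2 ^ m / Real.sqrt m := by
  classical
  have hJ := le_four_mul_card_half_le_abs_cos m x
  set J := (Finset.range m).filter fun a => 1 / 2 ≤ |Real.cos ((a : ℕ) * x)| with hJdef
  have h := card_subsetSum_mem_Icc_le (J := J) (I := Finset.range m) (Finset.filter_subset _ _)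
    (by omega) (fun a : ℕ => Real.cos (a * x)) (r := 1 / 2) (by norm_num)
    (fun i hi => (Finset.mem_filter.mp hi).2) y (by linarith : 0 ≤ l)
  refine h.trans ?_
  have hm' : (0 : ℝ) < m := by exact_mod_cast hm
  have h1 : Real.sqrt m ≤ 2 * Real.sqrt J.card := by
    rw [show (2 : ℝ) = Real.sqrt 4 by rw [show (4 : ℝ) = 2 ^ 2 by norm_num]; simp,
      ← Real.sqrt_mul (by norm_num)]
    exact Real.sqrt_le_sqrt (by exact_mod_cast hJ)
  have h2 : 0 < Real.sqrt m := Real.sqrt_pos.mpr hm'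
  rw [Finset.card_range]
  calc (l / (1 / 2) + 1) * (2 ^ m / Real.sqrt J.card)
      ≤ (3 * l) * (2 ^ m / (Real.sqrt m / 2)) := by
        gcongr
        · linarith
        · linarith
    _ = 6 * l * 2 ^ m / Real.sqrt m := by field_simp; ring

/-! ### Trigonometric polynomials and their zeros. -/

/-- `h` is a trigonometric polynomial with (half-integral) frequencies at most `D / 2`, of the
same parity as `D`. -/
def IsTrigPoly (D : ℕ) (h : ℝ → ℝ) : Prop :=
  ∃ P : Polynomial ℂ, P.natDegree ≤ D ∧
    ∀ x : ℝ, Complex.exp (D * (x / 2) * Complex.I) * h x = P.eval (Complex.exp (x * Complex.I))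

namespace IsTrigPoly

open Polynomial

theorem const (c : ℝ) : IsTrigPoly 0 fun _ => c :=
  ⟨C (c : ℂ), by simp, fun x => by simp⟩

theorem add {D : ℕ} {f g : ℝ → ℝ} (hf : IsTrigPoly D f) (hg : IsTrigPoly D g) :
    IsTrigPoly D fun x => f x + g x := by
  obtain ⟨P, hP, hP'⟩ := hf
  obtain ⟨Q, hQ, hQ'⟩ := hg
  refine ⟨P + Q, natDegree_add_le_of_degree_le hP hQ, fun x => ?_⟩
  rw [eval_add, ← hP', ← hQ']
  push_cast; ring

theorem mul {D E : ℕ} {f g : ℝ → ℝ} (hf : IsTrigPoly D f) (hg : IsTrigPoly E g) :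
    IsTrigPoly (D + E) fun x => f x * g x := by
  obtain ⟨P, hP, hP'⟩ := hf
  obtain ⟨Q, hQ, hQ'⟩ := hg
  refine ⟨P * Q, natDegree_mul_le_of_le hP hQ, fun x => ?_⟩
  rw [eval_mul, ← hP', ← hQ']
  push_cast
  rw [add_mul, add_mul, Complex.exp_add]; ring

theorem const_mul {D : ℕ} {f : ℝ → ℝ} (c : ℝ) (hf : IsTrigPoly D f) :
    IsTrigPoly D fun x => c * f x := by
  simpa using (const c).mul hf

theorem sub {D : ℕ} {f g : ℝ → ℝ} (hf : IsTrigPoly D f) (hg : IsTrigPoly D g) :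
    IsTrigPoly D fun x => f x - g x := by
  have := hf.add (hg.const_mul (-1))
  simpa [sub_eq_add_neg] using this

theorem add_two_mul {D : ℕ} {f : ℝ → ℝ} (hf : IsTrigPoly D f) (k : ℕ) :
    IsTrigPoly (D + 2 * k) f := by
  obtain ⟨P, hP, hP'⟩ := hf
  refine ⟨X ^ k * P, ?_, fun x => ?_⟩
  · exact (natDegree_mul_le_of_le (natDegree_X_pow_le k) hP).trans (by omega)
  · rw [eval_mul, ← hP', eval_pow, eval_X, ← Complex.exp_nat_mul, ← mul_assoc, ← Complex.exp_add]
    congr 2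
    push_cast; ring

theorem sum {ι : Type*} {D : ℕ} (hD : Even D) (s : Finset ι) (f : ι → ℝ → ℝ)
    (hf : ∀ i ∈ s, IsTrigPoly D (f i)) : IsTrigPoly D fun x => ∑ i ∈ s, f i x := by
  classical
  induction s using Finset.induction_on with
  | empty =>
    obtain ⟨k, rfl⟩ := hD
    have := (const 0).add_two_mul k
    simpa [two_mul] using this
  | insert a s ha ih =>
    have := (hf a (by simp)).add (ih fun i hi => hf i (by simp [hi]))
    simpa [Finset.sum_insert ha] using this

theorem sin_mul (D : ℕ) : IsTrigPoly D fun x => Real.sin (D * (x / 2)) := by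
  refine ⟨C (-Complex.I / 2) * (X ^ D - C 1), ?_, fun x => ?_⟩
  · refine (natDegree_C_mul_le _ _).trans (natDegree_X_pow_sub_C (r := (1 : ℂ)).le)
  · have h1 : Complex.exp (x * Complex.I) ^ D
        = Complex.exp (D * (x / 2) * Complex.I) * Complex.exp (D * (x / 2) * Complex.I) := by
      rw [← Complex.exp_nat_mul, ← Complex.exp_add]; congr 1; ring
    have h2 : Complex.exp (D * (x / 2) * Complex.I) * Complex.exp (-(D * (x / 2)) * Complex.I)
        = 1 := by
      rw [← Complex.exp_add]; simp
    simp only [eval_mul, eval_C, eval_sub, eval_pow, eval_X, h1]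
    push_cast
    rw [Complex.sin]
    linear_combination (Complex.I / 2) * h2

theorem cos_nat_mul (a : ℕ) : IsTrigPoly (2 * a) fun x => Real.cos (a * x) := by
  refine ⟨C (1 / 2) * (X ^ (2 * a) + C 1), ?_, fun x => ?_⟩
  · refine (natDegree_C_mul_le _ _).trans (natDegree_X_pow_add_C (r := (1 : ℂ)).le)
  · have h1 : Complex.exp (x * Complex.I) ^ (2 * a)
        = Complex.exp (a * x * Complex.I) * Complex.exp (a * x * Complex.I) := by
      rw [← Complex.exp_nat_mul, ← Complex.exp_add]; congr 1; push_cast; ring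
    have h2 : Complex.exp (a * x * Complex.I) * Complex.exp (-(a * x) * Complex.I)
        = 1 := by
      rw [← Complex.exp_add]; simp
    have h3 : ((2 * a : ℕ) : ℂ) * (x / 2) * Complex.I = a * x * Complex.I := by push_cast; ring
    simp only [eval_mul, eval_C, eval_add, eval_pow, eval_X, h1, h3]
    push_cast
    rw [Complex.cos]
    linear_combination (1 / 2) * h2

/-- Differentiation acts on the associated polynomial as `P ↦ i X P' - i (D / 2) P`, which does not
raise the degree bound. -/
theorem deriv_of_hasDerivAt {D : ℕ} {f f' : ℝ → ℝ} (hf : IsTrigPoly D f)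
    (hd : ∀ x, HasDerivAt f (f' x) x) : IsTrigPoly D f' := by
  obtain ⟨P, hP, hP'⟩ := hf
  refine ⟨C Complex.I * (X * derivative P) - C (D / 2 * Complex.I) * P, ?_, fun x => ?_⟩
  · refine (natDegree_sub_le_of_le ((natDegree_C_mul_le _ _).trans ?_)
      ((natDegree_C_mul_le _ _).trans hP)).trans (max_self D).le
    by_cases h0 : P.natDegree = 0
    · rw [eq_C_of_natDegree_eq_zero h0]; simp
    · refine (natDegree_mul_le_of_le natDegree_X_le (natDegree_derivative_le P)).trans ?_
      omega
  · have hx : HasDerivAt (fun y : ℝ => (y : ℂ)) 1 x := Complex.ofRealCLM.hasDerivAt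
    have e1 : HasDerivAt (fun y : ℝ => Complex.exp (D * (y / 2) * Complex.I))
        (Complex.exp (D * (x / 2) * Complex.I) * (D * (1 / 2) * Complex.I)) x :=
      (((hx.div_const 2).const_mul (D : ℂ)).mul_const Complex.I).cexp
    have e2 : HasDerivAt (fun y : ℝ => Complex.exp (y * Complex.I))
        (Complex.exp (x * Complex.I) * (1 * Complex.I)) x := (hx.mul_const Complex.I).cexp
    have e3 := e1.mul (hd x).ofReal_comp
    have e4 := (P.hasDerivAt (Complex.exp (x * Complex.I))).comp x e2
    have e5 := e3.unique (e4.congr_of_eventuallyEq (Filter.Eventually.of_forall fun y => hP' y))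
    simp only [eval_sub, eval_mul, eval_C, eval_X, ← hP']
    linear_combination e5

/-- Write `P = (X - z)^j R` with `R(z) ≠ 0`. As `e^{iy} - z` vanishes to exact order one at `x`, an
order above `j` for `h` would force `R(z) = 0` after dividing by `|y - x|^j` and letting `y → x`. -/
theorem order_le_rootMultiplicity {D : ℕ} {h : ℝ → ℝ} {P : ℂ[X]} (hP0 : P ≠ 0)
    (hP : ∀ x : ℝ,
      Complex.exp (D * (x / 2) * Complex.I) * h x = P.eval (Complex.exp (x * Complex.I)))
    (x : ℝ) (hx : AnalyticAt ℝ h x) :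
    analyticOrderAt h x ≤ P.rootMultiplicity (Complex.exp (x * Complex.I)) := by
  set z := Complex.exp (x * Complex.I) with hz
  set j := P.rootMultiplicity z with hj
  by_contra hlt
  rw [not_le] at hlt
  have hle : ((j + 1 : ℕ) : ℕ∞) ≤ analyticOrderAt h x := by
    push_cast; exact Order.add_one_le_of_lt hlt
  obtain ⟨g, hg, hgh⟩ := (natCast_le_analyticOrderAt hx).mp hle
  obtain ⟨R, hR, hRz⟩ := exists_eq_pow_rootMultiplicity_mul_and_not_dvd P hP0 z
  rw [dvd_iff_isRoot, IsRoot.def] at hRz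
  set e : ℝ → ℂ := fun y => Complex.exp (y * Complex.I) with he
  have hd : HasDerivAt e (z * Complex.I) x := by
    have hx : HasDerivAt (fun y : ℝ => (y : ℂ)) 1 x := Complex.ofRealCLM.hasDerivAt
    simpa using (hx.mul_const Complex.I).cexp
  set q := dslope e x with hq
  have hqc : ContinuousAt q x := continuousAt_dslope_same.mpr hd.differentiableAt
  have hqx : q x = z * Complex.I := by rw [hq, dslope_same, hd.deriv]
  have hqe : ∀ y, e y - z = ((y - x : ℝ) : ℂ) * q y := by
    intro y
    have := sub_smul_dslope e x y
    rw [hq, ← Complex.real_smul, this]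
  have hev : ∀ᶠ y in nhdsWithin x {x}ᶜ,
      ‖q y‖ ^ j * ‖R.eval (e y)‖ = |y - x| * |g y| := by
    filter_upwards [nhdsWithin_le_nhds hgh, self_mem_nhdsWithin] with y hy hyx
    have hyx' : 0 < |y - x| := abs_pos.mpr (sub_ne_zero.mpr hyx)
    have h1 := congrArg norm (hP y)
    have h2 : ‖Complex.exp (D * (y / 2) * Complex.I)‖ = 1 := by
      have := Complex.norm_exp_ofReal_mul_I (D * (y / 2))
      push_cast at this; exact this
    rw [norm_mul, h2, one_mul, hR, eval_mul, eval_pow, eval_sub, eval_X, eval_C, norm_mul,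
      norm_pow, ← hj] at h1
    change _ = ‖e y - z‖ ^ j * ‖eval (e y) R‖ at h1
    rw [hqe, norm_mul, Complex.norm_real, Complex.norm_real, hy, norm_smul, norm_pow,
      Real.norm_eq_abs, Real.norm_eq_abs, mul_pow, pow_succ] at h1
    have h3 : |y - x| ^ j ≠ 0 := (pow_pos hyx' j).ne'
    apply mul_left_cancel₀ h3
    linear_combination -h1
  have t1 : Filter.Tendsto (fun y => ‖q y‖ ^ j * ‖R.eval (e y)‖) (nhdsWithin x {x}ᶜ)
      (nhds (‖q x‖ ^ j * ‖R.eval (e x)‖)) := by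
    refine Filter.Tendsto.mono_left ?_ nhdsWithin_le_nhds
    exact ((hqc.norm.pow j).mul (R.continuous.continuousAt.comp hd.continuousAt).norm)
  have t2 : Filter.Tendsto (fun y => |y - x| * |g y|) (nhdsWithin x {x}ᶜ)
      (nhds (|x - x| * |g x|)) := by
    refine Filter.Tendsto.mono_left ?_ nhdsWithin_le_nhds
    have : ContinuousAt (fun y => |y - x| * |g y|) x :=
      (by fun_prop : ContinuousAt (fun y : ℝ => |y - x|) x).mul hg.continuousAt.abs
    exact this
  have h0 := tendsto_nhds_unique (t1.congr' hev) t2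
  rw [sub_self, abs_zero, zero_mul, hqx] at h0
  have hz0 : z ≠ 0 := Complex.exp_ne_zero _
  have : ‖z * Complex.I‖ ^ j * ‖R.eval z‖ ≠ 0 :=
    mul_ne_zero (pow_ne_zero _ (norm_ne_zero_iff.mpr (mul_ne_zero hz0 Complex.I_ne_zero)))
      (norm_ne_zero_iff.mpr hRz)
  exact this h0

theorem injOn_exp : Set.InjOn (fun x : ℝ => Complex.exp (x * Complex.I))
    (Set.Ico 0 (2 * Real.pi)) := by
  intro x hx y hy hxy
  simp only at hxy
  rw [Complex.exp_eq_exp_iff_exists_int] at hxy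
  obtain ⟨n, hn⟩ := hxy
  have h1 : x = y + n * (2 * Real.pi) := by
    have : (x : ℂ) = y + n * (2 * Real.pi) := by
      apply mul_right_cancel₀ Complex.I_ne_zero
      rw [hn]; ring
    exact_mod_cast this
  have hp := Real.pi_pos
  have h2 : (n : ℝ) < 1 := by
    by_contra h
    rw [not_lt] at h
    nlinarith [hx.2, hy.1]
  have h3 : (-1 : ℝ) < n := by
    by_contra h
    rw [not_lt] at h
    nlinarith [hx.1, hy.2]
  have h4 : n = 0 := by
    have a : n < 1 := by exact_mod_cast h2
    have b : -1 < n := by exact_mod_cast h3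
    omega
  simpa [h4] using h1

/-- A nonzero trigonometric polynomial has at most `D` zeros in `[0, 2π)`, with multiplicity. -/
theorem sum_order_le {D : ℕ} {h : ℝ → ℝ} (hh : IsTrigPoly D h) (ha : ∀ x, AnalyticAt ℝ h x)
    (h0 : ∃ x, h x ≠ 0) (S : Finset ℝ) (hS : (S : Set ℝ) ⊆ Set.Ico 0 (2 * Real.pi)) :
    ∑ x ∈ S, analyticOrderAt h x ≤ D := by
  classical
  obtain ⟨P, hP, hP'⟩ := hh
  have hP0 : P ≠ 0 := by
    rintro rfl
    obtain ⟨x, hx⟩ := h0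
    have := hP' x
    rw [eval_zero, mul_eq_zero] at this
    rcases this with h | h
    · exact Complex.exp_ne_zero _ h
    · exact hx (by exact_mod_cast h)
  calc ∑ x ∈ S, analyticOrderAt h x
      ≤ ∑ x ∈ S, ((P.rootMultiplicity (Complex.exp (x * Complex.I)) : ℕ) : ℕ∞) :=
        Finset.sum_le_sum fun x _ => order_le_rootMultiplicity hP0 hP' x (ha x)
    _ = ((∑ x ∈ S, P.rootMultiplicity (Complex.exp (x * Complex.I)) : ℕ) : ℕ∞) := by
        push_cast; rfl
    _ ≤ D := by
        norm_cast
        rw [← Finset.sum_image (f := fun z => P.rootMultiplicity z)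
          (g := fun x : ℝ => Complex.exp (x * Complex.I)) (injOn_exp.mono hS)]
        simp only [← count_roots]
        refine le_trans ?_ ((card_roots' P).trans hP)
        rw [← Multiset.sum_count_eq_card (s := S.image (fun x : ℝ => Complex.exp (x * Complex.I)) ∪
          P.roots.toFinset) (m := P.roots) fun a ha =>
            Finset.mem_union_right _ (Multiset.mem_toFinset.mpr ha)]
        exact Finset.sum_le_sum_of_subset Finset.subset_union_left

end IsTrigPoly

/-! ### Rolle-type comparison of zeros with multiplicity. -/

theorem analyticOrderAt_le_deriv_add_one {u : ℝ → ℝ} {x : ℝ} (hu : AnalyticAt ℝ u x) :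
    analyticOrderAt u x ≤ analyticOrderAt (deriv u) x + 1 := by
  by_cases h : u x = 0
  · rw [hu.analyticOrderAt_deriv_add_one]
    simp [h]
  · rw [hu.analyticOrderAt_eq_zero.mpr h]
    exact zero_le

/-- If `v` vanishes between any two zeros of `u`, and to order at most one less at the zeros of
`u`, then `v` has at most one zero less than `u`, with multiplicity. -/
theorem exists_finset_sum_order_le {u v : ℝ → ℝ} {I : Set ℝ} (hI : I.OrdConnected)
    (hv : ∀ x, AnalyticAt ℝ v x)
    (h1 : ∀ x ∈ I, analyticOrderAt u x ≤ analyticOrderAt v x + 1)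
    (h2 : ∀ a ∈ I, ∀ b ∈ I, a < b → u a = 0 → u b = 0 → ∃ c ∈ Set.Ioo a b, v c = 0)
    (S : Finset ℝ) (hS : (S : Set ℝ) ⊆ I) :
    ∃ S' : Finset ℝ, (S' : Set ℝ) ⊆ I ∧
      ∑ x ∈ S, analyticOrderAt u x ≤ ∑ x ∈ S', analyticOrderAt v x + 1 := by
  classical
  -- The invariant that `S'` does not pass the largest point of `S` keeps each new intermediate zero
  -- `c` distinct from the earlier points.
  suffices H : ∀ S : Finset ℝ, (S : Set ℝ) ⊆ I → (∀ x ∈ S, u x = 0) →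
      ∃ S' : Finset ℝ, (S' : Set ℝ) ⊆ I ∧ (∀ y ∈ S', ∃ x ∈ S, y ≤ x) ∧
        ∑ x ∈ S, analyticOrderAt u x ≤ ∑ x ∈ S', analyticOrderAt v x + 1 by
    obtain ⟨S', hS', -, h⟩ := H (S.filter fun x => u x = 0)
      (fun x hx => hS (Finset.mem_filter.mp hx).1) fun x hx => (Finset.mem_filter.mp hx).2
    refine ⟨S', hS', le_trans (le_of_eq ?_) h⟩
    refine (Finset.sum_filter_of_ne fun x _ hx => ?_).symm
    exact apply_eq_zero_of_analyticOrderAt_ne_zero hx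
  intro S
  induction S using Finset.induction_on_max with
  | empty => exact fun _ _ => ⟨∅, by simp, by simp, by simp⟩
  | insert b S hlt ih =>
    intro hSI hS0
    have hbI : b ∈ I := hSI (by simp)
    have hb0 : u b = 0 := hS0 b (by simp)
    have hbS : b ∉ S := fun h => lt_irrefl b (hlt b h)
    rcases S.eq_empty_or_nonempty with rfl | hne
    · refine ⟨{b}, by simpa using hbI, by simp, ?_⟩
      simpa using h1 b hbI
    · obtain ⟨S', hS'I, hS'le, hsum⟩ := ih (fun x hx => hSI (by simp at hx; simp [hx]))
        fun x hx => hS0 x (by simp [hx])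
      set a := S.max' hne with ha
      have haS : a ∈ S := S.max'_mem hne
      have haI : a ∈ I := hSI (by simp [haS])
      obtain ⟨c, hc, hvc⟩ := h2 a haI b hbI (hlt a haS) (hS0 a (by simp [haS])) hb0
      have hcS' : ∀ y ∈ S', y < c := by
        intro y hy
        obtain ⟨x, hx, hyx⟩ := hS'le y hy
        exact (hyx.trans (S.le_max' x hx)).trans_lt hc.1
      have hcn : c ∉ S' := fun h => lt_irrefl c (hcS' c h)
      have hbn : b ∉ insert c S' := by
        intro h
        rcases Finset.mem_insert.mp h with h | h
        · exact absurd hc.2 (by simp [h])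
        · exact lt_irrefl b ((hcS' b h).trans hc.2)
      refine ⟨insert b (insert c S'), ?_, ?_, ?_⟩
      · intro y hy
        simp only [Finset.coe_insert, Set.mem_insert_iff, Finset.mem_coe] at hy
        rcases hy with rfl | rfl | hy
        · exact hbI
        · exact hI.out haI hbI ⟨hc.1.le, hc.2.le⟩
        · exact hS'I hy
      · intro y hy
        refine ⟨b, by simp, ?_⟩
        simp only [Finset.mem_insert] at hy
        rcases hy with rfl | rfl | hy
        · exact le_rfl
        · exact hc.2.le
        · exact ((hcS' y hy).trans hc.2).le
      · have hc1 : 1 ≤ analyticOrderAt v c := by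
          rw [Order.one_le_iff_ne_zero]
          exact (hv c).analyticOrderAt_ne_zero.mpr hvc
        rw [Finset.sum_insert hbS, Finset.sum_insert hbn, Finset.sum_insert hcn]
        calc analyticOrderAt u b + ∑ x ∈ S, analyticOrderAt u x
            ≤ (analyticOrderAt v b + 1) + (∑ x ∈ S', analyticOrderAt v x + 1) :=
              add_le_add (h1 b hbI) hsum
          _ ≤ (analyticOrderAt v b + analyticOrderAt v c) +
                (∑ x ∈ S', analyticOrderAt v x + 1) := by gcongr
          _ = _ := by ring

/-- On an interval shorter than `π / M`, `u` has at most two zeros more than `u'' + M² u`. -/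
theorem exists_finset_sum_order_le_add_two {u : ℝ → ℝ} (hu : ∀ x, AnalyticAt ℝ u x)
    {M δ a : ℝ} (hM : 0 < M) (hδ : M * δ < Real.pi)
    (S : Finset ℝ) (hS : (S : Set ℝ) ⊆ Set.Ico a (a + δ)) :
    ∃ S' : Finset ℝ, (S' : Set ℝ) ⊆ Set.Ico a (a + δ) ∧
      ∑ x ∈ S, analyticOrderAt u x
        ≤ ∑ x ∈ S', analyticOrderAt (fun x => deriv (deriv u) x + M ^ 2 * u x) x + 2 := by
  -- A solution of `w'' + M² w = 0` that is positive on the interval, since `M δ < π` and the cosine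
  -- is centred at the midpoint.
  set w : ℝ → ℝ := fun x => Real.cos (M * (x - (a + δ / 2))) with hw
  set w' : ℝ → ℝ := fun x => -(M * Real.sin (M * (x - (a + δ / 2)))) with hw'
  have hin : ∀ x, HasDerivAt (fun x => M * (x - (a + δ / 2))) M x := fun x => by
    simpa using ((hasDerivAt_id x).sub_const (a + δ / 2)).const_mul M
  have dw : ∀ x, HasDerivAt w (w' x) x := fun x => by
    have := (hin x).cos
    exact this.congr_deriv (by simp only [hw']; ring)
  have dw' : ∀ x, HasDerivAt w' (-(M ^ 2 * w x)) x := fun x => by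
    have := ((hin x).sin.const_mul M).neg
    exact this.congr_deriv (by simp only [hw]; ring)
  have du : ∀ x, HasDerivAt u (deriv u x) x := fun x => (hu x).differentiableAt.hasDerivAt
  have du' : ∀ x, HasDerivAt (deriv u) (deriv (deriv u) x) x :=
    fun x => (hu x).deriv.differentiableAt.hasDerivAt
  have aw : ∀ x, AnalyticAt ℝ w x := fun x => by
    fun_prop
  have aw' : ∀ x, AnalyticAt ℝ w' x := fun x => by
    have : w' = deriv w := funext fun y => (dw y).deriv.symm
    rw [this]; exact (aw x).deriv
  -- The Wronskian: `(u / w)' = v / w²` and `v' = w (u'' + M² u)`. Each of the two Rolle steps costs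
  -- one zero.
  set v : ℝ → ℝ := fun x => deriv u x * w x - u x * w' x with hv
  have av : ∀ x, AnalyticAt ℝ v x := fun x =>
    ((hu x).deriv.mul (aw x)).sub ((hu x).mul (aw' x))
  have wpos : ∀ x ∈ Set.Ico a (a + δ), 0 < w x := by
    intro x hx
    apply Real.cos_pos_of_mem_Ioo
    constructor <;> nlinarith [hx.1, hx.2]
  have hI : (Set.Ico a (a + δ)).OrdConnected := Set.ordConnected_Ico
  obtain ⟨S₁, hS₁, h₁⟩ := exists_finset_sum_order_le (u := u) (v := v) hI av
    (fun x _ => by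
      have e : analyticOrderAt (deriv u) x ⊓ analyticOrderAt u x ≤ analyticOrderAt v x := by
        refine le_trans ?_ (le_analyticOrderAt_sub (f := fun x => deriv u x * w x)
          (g := fun x => u x * w' x))
        have e1 := analyticOrderAt_mul (hu x).deriv (aw x)
        have e2 := analyticOrderAt_mul (hu x) (aw' x)
        change analyticOrderAt (fun x => deriv u x * w x) x = _ at e1
        change analyticOrderAt (fun x => u x * w' x) x = _ at e2
        rw [e1, e2]
        exact inf_le_inf (le_self_add) (le_self_add)
      have e3 : analyticOrderAt u x ≤ (analyticOrderAt (deriv u) x ⊓ analyticOrderAt u x) + 1 := by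
        rcases le_total (analyticOrderAt (deriv u) x) (analyticOrderAt u x) with h | h
        · rw [inf_eq_left.mpr h]; exact analyticOrderAt_le_deriv_add_one (hu x)
        · rw [inf_eq_right.mpr h]; exact le_self_add
      exact e3.trans (by gcongr))
    (fun p hp q hq hpq hup huq => by
      have hsub : Set.Icc p q ⊆ Set.Ico a (a + δ) := hI.out hp hq
      obtain ⟨c, hc, hc0⟩ := exists_hasDerivAt_eq_zero (f := fun x => u x / w x)
        (f' := fun x => v x / w x ^ 2) hpq
        (fun x hx => ((du x).div (dw x) (wpos x (hsub hx)).ne').continuousAt.continuousWithinAt)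
        (by simp [hup, huq])
        (fun x hx => (du x).div (dw x) (wpos x (hsub (Set.Ioo_subset_Icc_self hx))).ne')
      refine ⟨c, hc, ?_⟩
      have hwc := (wpos c (hsub (Set.Ioo_subset_Icc_self hc))).ne'
      simpa [hwc] using hc0) S hS
  have dv : ∀ x, HasDerivAt v (w x * (deriv (deriv u) x + M ^ 2 * u x)) x := fun x => by
    have := ((du' x).mul (dw x)).sub ((du x).mul (dw' x))
    exact this.congr_deriv (by ring)
  obtain ⟨S₂, hS₂, h₂⟩ := exists_finset_sum_order_le (u := v) (v := deriv v) hI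
    (fun x => (av x).deriv) (fun x _ => analyticOrderAt_le_deriv_add_one (av x))
    (fun p _ q _ hpq hvp hvq => by
      obtain ⟨c, hc, hc0⟩ := exists_deriv_eq_zero (f := v) hpq
        (fun x _ => (av x).continuousAt.continuousWithinAt) (by rw [hvp, hvq])
      exact ⟨c, hc, hc0⟩) S₁ hS₁
  refine ⟨S₂, hS₂, ?_⟩
  have h₃ : ∑ x ∈ S₂, analyticOrderAt (deriv v) x
      = ∑ x ∈ S₂, analyticOrderAt (fun x => deriv (deriv u) x + M ^ 2 * u x) x := by
    refine Finset.sum_congr rfl fun x hx => ?_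
    have hdv : deriv v = w * fun x => deriv (deriv u) x + M ^ 2 * u x :=
      funext fun y => (dv y).deriv
    have aW : AnalyticAt ℝ (fun x => deriv (deriv u) x + M ^ 2 * u x) x :=
      (hu x).deriv.deriv.add (analyticAt_const.mul (hu x))
    rw [hdv, analyticOrderAt_mul (aw x) aW,
      (aw x).analyticOrderAt_eq_zero.mpr (wpos x (hS₂ hx)).ne', zero_add]
  calc _ ≤ _ := h₁
    _ ≤ (∑ x ∈ S₂, analyticOrderAt (deriv v) x + 1) + 1 := by gcongr
    _ = _ := by rw [h₃, add_assoc]; norm_num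

/-! ### Counting zeros cell by cell. -/

theorem mem_Ico_grid_iff {d : ℝ} (hd : 0 < d) {x : ℝ} (hx : 0 ≤ x) (j : ℕ) :
    x ∈ Set.Ico (j * d) (j * d + d) ↔ ⌊x / d⌋₊ = j := by
  rw [Nat.floor_eq_iff (div_nonneg hx hd.le), le_div_iff₀ hd, div_lt_iff₀ hd, Set.mem_Ico, add_mul,
    one_mul]

/-- The zeros of `sin (M x) + T x`: only grid intervals on which `|T| ≤ 1` somewhere matter. -/
theorem sum_order_le_of_grid {F T : ℝ → ℝ} {M : ℝ} {L D E : ℕ} (hM : 0 < M) (hML : M < L)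
    (hF : ∀ x, F x = Real.sin (M * x) + T x) (aT : ∀ x, AnalyticAt ℝ T x)
    (hW : IsTrigPoly D fun x => deriv (deriv F) x + M ^ 2 * F x)
    (hW0 : ∃ x, deriv (deriv F) x + M ^ 2 * F x ≠ 0)
    (hT : IsTrigPoly E fun x => T x ^ 2 - 1) (hT0 : ∃ x, T x ^ 2 - 1 ≠ 0)
    (S : Finset ℝ) (hS : (S : Set ℝ) ⊆ Set.Ico 0 (2 * Real.pi)) :
    ∑ x ∈ S, analyticOrderAt F x
      ≤ ((2 * (((Finset.range (2 * L)).filter fun j : ℕ => |T (j * (Real.pi / L))| ≤ 1).card + E)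
          + D : ℕ) : ℕ∞) := by
  classical
  have hL : (0 : ℝ) < L := hM.trans hML
  set d : ℝ := Real.pi / L with hd
  have hd0 : 0 < d := div_pos Real.pi_pos hL
  have aF : ∀ x, AnalyticAt ℝ F x := fun x => by
    rw [show F = fun x => Real.sin (M * x) + T x from funext hF]
    have : AnalyticAt ℝ (fun x => Real.sin (M * x)) x := by fun_prop
    exact this.add (aT x)
  set bad := (Finset.range (2 * L)).filter fun j : ℕ => |T (j * d)| ≤ 1 with hbad
  set hit := (Finset.range (2 * L)).filter
    fun j : ℕ => ∃ y ∈ Set.Ico (j * d) (j * d + d), F y = 0 with hhit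
  have hMd : M * d < Real.pi := by
    rw [hd, ← mul_div_assoc, div_lt_iff₀ hL, mul_comm]
    exact mul_lt_mul_of_pos_left hML Real.pi_pos
  have hgrid : ∀ j < 2 * L, Set.Ico (j * d) (j * d + d) ⊆ Set.Ico 0 (2 * Real.pi) := by
    intro j hj x hx
    have h1 : ((j : ℝ) + 1) * d ≤ (2 * L) * d := by
      gcongr
      exact_mod_cast hj
    have h2 : 2 * L * d = 2 * Real.pi := by rw [hd]; field_simp
    have h3 : 0 ≤ j * d := by positivity
    exact ⟨h3.trans hx.1, by linarith [hx.2]⟩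
  have hcount : hit.card ≤ bad.card + E := by
    -- Here `|T| > 1` at the left endpoint, while `|T| = |sin (M y)| ≤ 1` at a zero `y` of `F`, so
    -- `|T| = 1` in between.
    have hex : ∀ j ∈ hit \ bad, ∃ y ∈ Set.Ico (j * d) (j * d + d), T y ^ 2 - 1 = 0 := by
      intro j hj
      simp only [hhit, hbad, Finset.mem_sdiff, Finset.mem_filter, not_and, not_le] at hj
      obtain ⟨⟨hjL, y, hy, hFy⟩, hj2⟩ := hj
      have hj3 := hj2 hjL
      have hTy : |T y| ≤ 1 := by
        have : T y = -Real.sin (M * y) := by linarith [hF y]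
        rw [this, abs_neg]; exact Real.abs_sin_le_one _
      have cT : ContinuousOn (fun x => |T x|) (Set.Icc (j * d) y) :=
        fun x _ => (aT x).continuousAt.abs.continuousWithinAt
      obtain ⟨z, hz, hz1⟩ := intermediate_value_Icc' hy.1 cT ⟨hTy, hj3.le⟩
      refine ⟨z, ⟨hz.1, hz.2.trans_lt hy.2⟩, ?_⟩
      simp only at hz1
      rw [← sq_abs, hz1]; norm_num
    choose! y hy hy0 using hex
    have hrange : ∀ j ∈ hit \ bad, j < 2 * L := fun j hj =>
      Finset.mem_range.mp (Finset.mem_filter.mp (Finset.mem_sdiff.mp hj).1).1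
    have hinj : Set.InjOn y (hit \ bad : Finset ℕ) := by
      intro i hi j hj hij
      have h1 := (mem_Ico_grid_iff hd0 (hgrid i (hrange i hi) (hy i hi)).1 i).mp (hy i hi)
      have h2 := (mem_Ico_grid_iff hd0 (hgrid j (hrange j hj) (hy j hj)).1 j).mp (hy j hj)
      rw [← h1, ← h2, hij]
    have h1 : ((hit \ bad).card : ℕ∞) ≤ E := by
      rw [← Finset.card_image_of_injOn hinj]
      refine le_trans ?_ (hT.sum_order_le (fun x => ((aT x).pow 2).sub analyticAt_const) hT0
        ((hit \ bad).image y) ?_)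
      · rw [Finset.card_eq_sum_ones]
        push_cast
        refine Finset.sum_le_sum fun x hx => ?_
        obtain ⟨j, hj, rfl⟩ := Finset.mem_image.mp hx
        rw [Order.one_le_iff_ne_zero]
        exact ((((aT (y j)).pow 2).sub analyticAt_const).analyticOrderAt_ne_zero).mpr (hy0 j hj)
      · intro x hx
        obtain ⟨j, hj, rfl⟩ := Finset.mem_image.mp (Finset.mem_coe.mp hx)
        exact hgrid j (hrange j hj) (hy j hj)
    have h2 : (hit \ bad).card ≤ E := by exact_mod_cast h1
    have h3 := Finset.card_le_card_sdiff_add_card (s := hit) (t := bad)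
    omega
  set W : ℝ → ℝ := fun x => deriv (deriv F) x + M ^ 2 * F x with hWdef
  set idx : ℝ → ℕ := fun x => ⌊x / d⌋₊ with hidx
  have hidx_lt : ∀ x ∈ S, idx x ∈ Finset.range (2 * L) := by
    intro x hx
    have h := hS hx
    rw [Finset.mem_range, hidx, Nat.floor_lt (div_nonneg h.1 hd0.le), div_lt_iff₀ hd0]
    have h2 : 2 * L * d = 2 * Real.pi := by rw [hd]; field_simp
    push_cast
    rw [h2]; exact h.2
  have hlocal : ∀ j ∈ Finset.range (2 * L), ∃ S' : Finset ℝ,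
      (S' : Set ℝ) ⊆ Set.Ico (j * d) (j * d + d) ∧
      ∑ x ∈ S.filter (fun x => idx x = j), analyticOrderAt F x
        ≤ ∑ x ∈ S', analyticOrderAt W x + if j ∈ hit then 2 else 0 := by
    intro j hj
    have hSj : ∀ x ∈ S.filter (fun x => idx x = j), x ∈ Set.Ico (j * d) (j * d + d) := by
      intro x hx
      obtain ⟨hxS, hxj⟩ := Finset.mem_filter.mp hx
      exact (mem_Ico_grid_iff hd0 (hS hxS).1 j).mpr hxj
    by_cases hjh : j ∈ hit
    · simpa [hjh] using exists_finset_sum_order_le_add_two aF hM hMd _ hSj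
    · refine ⟨∅, by simp, ?_⟩
      rw [Finset.sum_eq_zero]
      · exact zero_le
      · intro x hx
        by_contra h
        exact hjh (Finset.mem_filter.mpr ⟨hj, x, hSj x hx,
          apply_eq_zero_of_analyticOrderAt_ne_zero h⟩)
  choose! S' hS' hS'le using hlocal
  have hdisj : ∀ i ∈ Finset.range (2 * L), ∀ j ∈ Finset.range (2 * L), i ≠ j →
      Disjoint (S' i) (S' j) := by
    intro i hi j hj hij
    rw [Finset.disjoint_left]
    intro x hxi hxj
    have h1 := hS' i hi hxi
    have h2 := hS' j hj hxj
    have h0 := (hgrid i (Finset.mem_range.mp hi) h1).1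
    exact hij (((mem_Ico_grid_iff hd0 h0 i).mp h1).symm.trans ((mem_Ico_grid_iff hd0 h0 j).mp h2))
  have aW : ∀ x, AnalyticAt ℝ W x := fun x =>
    (aF x).deriv.deriv.add (analyticAt_const.mul (aF x))
  -- The cells are disjoint, so the zeros of `W` are charged to its degree only once.
  have hsum : ∑ j ∈ Finset.range (2 * L), ∑ x ∈ S' j, analyticOrderAt W x ≤ D := by
    rw [← Finset.sum_biUnion (by exact fun i hi j hj hij => hdisj i hi j hj hij)]
    refine hW.sum_order_le aW hW0 _ ?_
    intro x hx
    obtain ⟨j, hj, hxj⟩ := Finset.mem_biUnion.mp (Finset.mem_coe.mp hx)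
    exact hgrid j (Finset.mem_range.mp hj) (hS' j hj hxj)
  calc ∑ x ∈ S, analyticOrderAt F x
      = ∑ j ∈ Finset.range (2 * L), ∑ x ∈ S.filter (fun x => idx x = j), analyticOrderAt F x :=
        (Finset.sum_fiberwise_of_maps_to hidx_lt _).symm
    _ ≤ ∑ j ∈ Finset.range (2 * L),
          (∑ x ∈ S' j, analyticOrderAt W x + if j ∈ hit then 2 else 0) :=
        Finset.sum_le_sum hS'le
    _ = ∑ j ∈ Finset.range (2 * L), ∑ x ∈ S' j, analyticOrderAt W x + ((hit.card * 2 : ℕ) : ℕ∞) := by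
        rw [Finset.sum_add_distrib, ← Finset.sum_filter]
        congr 1
        have : (Finset.range (2 * L)).filter (fun j => j ∈ hit) = hit := by
          rw [Finset.filter_mem_eq_inter, Finset.inter_eq_right]
          exact Finset.filter_subset _ _
        rw [this, Finset.sum_const, nsmul_eq_mul]; push_cast; rfl
    _ ≤ (D : ℕ∞) + ((2 * (bad.card + E) : ℕ) : ℕ∞) := by
        refine add_le_add hsum ?_
        norm_cast
        omega
    _ = _ := by push_cast; ring

/-! ### Cosine polynomials and the two-block set. -/

theorem zeroCount_le_of_forall {f : ℝ → ℝ} {B : ℕ∞}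
    (h : ∀ S : Finset ℝ, (S : Set ℝ) ⊆ zeroSet f → ∑ x ∈ S, analyticOrderAt f x ≤ B) :
    zeroCount f ≤ B :=
  iSup₂_le h

theorem analyticAt_cosPoly (A : Finset ℕ) (x : ℝ) : AnalyticAt ℝ (cosPoly A) x := by
  have : AnalyticAt ℝ (fun x : ℝ => ∑ a ∈ A, Real.cos (a * x)) x := by
    refine Finset.analyticAt_fun_sum _ fun a _ => ?_
    fun_prop
  exact this

theorem cosPoly_zero (A : Finset ℕ) : cosPoly A 0 = A.card := by
  simp [cosPoly]

theorem cosPoly_two_pi (A : Finset ℕ) : cosPoly A (2 * Real.pi) = A.card := by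
  simp [cosPoly, Real.cos_nat_mul_two_pi]

theorem zeroSet_cosPoly_subset {A : Finset ℕ} (hA : A.Nonempty) :
    zeroSet (cosPoly A) ⊆ Set.Ioo 0 (2 * Real.pi) := by
  rintro x ⟨⟨h0, h1⟩, hx⟩
  have hc : (A.card : ℝ) ≠ 0 := by exact_mod_cast hA.card_pos.ne'
  refine ⟨lt_of_le_of_ne h0 ?_, lt_of_le_of_ne h1 ?_⟩
  · rintro rfl; exact hc (by rw [← cosPoly_zero, hx])
  · rintro rfl; exact hc (by rw [← cosPoly_two_pi, hx])

theorem isTrigPoly_cosPoly {A : Finset ℕ} {k : ℕ} (hA : ∀ a ∈ A, a ≤ k) :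
    IsTrigPoly (2 * k) (cosPoly A) := by
  refine IsTrigPoly.sum (even_two_mul k) A (fun a x => Real.cos (a * x)) fun a ha => ?_
  have := (IsTrigPoly.cos_nat_mul a).add_two_mul (k - a)
  rwa [show 2 * a + 2 * (k - a) = 2 * k by have := hA a ha; omega] at this

theorem zeroCount_cosPoly_le {A : Finset ℕ} (hA : A.Nonempty) {k : ℕ} (hk : ∀ a ∈ A, a ≤ k) :
    zeroCount (cosPoly A) ≤ ((2 * k : ℕ) : ℕ∞) := by
  refine zeroCount_le_of_forall fun S hS => ?_
  refine (isTrigPoly_cosPoly hk).sum_order_le (analyticAt_cosPoly A) ⟨0, ?_⟩ S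
    fun x hx => Set.Ioo_subset_Ico_self (zeroSet_cosPoly_subset hA (hS hx))
  rw [cosPoly_zero]
  exact_mod_cast hA.card_pos.ne'

theorem two_mul_sin_half_mul_cosPoly_Ico {a b : ℕ} (hab : a ≤ b) (x : ℝ) :
    2 * Real.sin (x / 2) * cosPoly (Finset.Ico a b) x
      = Real.sin ((b - 1 / 2) * x) - Real.sin ((a - 1 / 2) * x) := by
  induction b, hab using Nat.le_induction with
  | base => simp [cosPoly]
  | succ b hab ih =>
    have h : cosPoly (Finset.Ico a (b + 1)) x = cosPoly (Finset.Ico a b) x + Real.cos (b * x) := by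
      rw [cosPoly, Finset.sum_Ico_succ_top hab, cosPoly]
    rw [h, mul_add, ih]
    have e1 : ((b + 1 : ℕ) - 1 / 2 : ℝ) * x = b * x + x / 2 := by push_cast; ring
    have e2 : ((b : ℝ) - 1 / 2) * x = b * x - x / 2 := by ring
    rw [e1, e2, Real.sin_add, Real.sin_sub]
    ring

/-- Otherwise a polynomial with constant term `1` would vanish on the whole unit circle. This shows
that `F'' + M² F` is not identically zero. -/
theorem IsTrigPoly.not_sin_mul (D : ℕ) :
    ¬ IsTrigPoly D fun x => Real.sin ((D + 2 : ℕ) * (x / 2)) := by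
  rintro ⟨P, -, hP⟩
  set Q : Polynomial ℂ := Polynomial.C (2 * Complex.I) * (Polynomial.X * P)
    - (Polynomial.X ^ (D + 2) - Polynomial.C 1) with hQ
  have hroot : ∀ x : ℝ, Q.eval (Complex.exp (x * Complex.I)) = 0 := by
    intro x
    have h1 : Complex.exp (x * Complex.I) ^ (D + 2)
        = Complex.exp (x * Complex.I) * Complex.exp (D * (x / 2) * Complex.I) *
          Complex.exp ((D + 2) * (x / 2) * Complex.I) := by
      rw [← Complex.exp_nat_mul, ← Complex.exp_add, ← Complex.exp_add]
      congr 1; push_cast; ring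
    have h2 : Complex.exp (x * Complex.I) * Complex.exp (D * (x / 2) * Complex.I) *
        Complex.exp (-((D + 2) * (x / 2)) * Complex.I) = 1 := by
      rw [← Complex.exp_add, ← Complex.exp_add, Complex.exp_eq_one_iff]
      exact ⟨0, by push_cast; ring⟩
    simp only [hQ, Polynomial.eval_sub, Polynomial.eval_mul, Polynomial.eval_pow,
      Polynomial.eval_C, Polynomial.eval_X, ← hP, h1]
    push_cast
    rw [Complex.sin]
    linear_combination (-1 : ℂ) * h2 +
      Complex.exp (x * Complex.I) * Complex.exp (D * (x / 2) * Complex.I) *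
      (Complex.exp (-((D + 2) * (x / 2)) * Complex.I)
        - Complex.exp ((D + 2) * (x / 2) * Complex.I)) * Complex.I_sq
  have hQ0 : Q = 0 := by
    apply Polynomial.eq_zero_of_infinite_isRoot
    refine Set.Infinite.mono ?_
      ((Set.infinite_image_iff IsTrigPoly.injOn_exp).mpr (Set.Ico_infinite Real.two_pi_pos))
    rintro _ ⟨x, -, rfl⟩
    exact hroot x
  have := congrArg (Polynomial.eval 0) hQ0
  simp [hQ] at this

/-- `2 sin (x / 2) cosPoly S x` minus the lower boundary term of the kernel of `[m + 1, N)`. -/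
noncomputable def lowFrequencyPart (m : ℕ) (S : Finset ℕ) (x : ℝ) : ℝ :=
  2 * Real.sin (x / 2) * cosPoly S x - Real.sin ((2 * m + 1 : ℕ) * (x / 2))

theorem isTrigPoly_two_mul_sin_half_mul_cosPoly {A : Finset ℕ} {k : ℕ} (hA : ∀ a ∈ A, a ≤ k) :
    IsTrigPoly (2 * k + 1) fun x => 2 * Real.sin (x / 2) * cosPoly A x := by
  have h1 : IsTrigPoly 1 fun x => 2 * Real.sin (x / 2) := by
    have := (IsTrigPoly.sin_mul 1).const_mul 2
    simpa using this
  have := h1.mul (isTrigPoly_cosPoly hA)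
  rwa [add_comm] at this

/-- Starting the block at `m + 1` rather than `m` gives its lower boundary term the frequency `m + 1
/ 2`, above every frequency of `2 sin (x / 2) f_S`, so nothing can cancel it. -/
theorem zeroCount_cosPoly_union_le {m N L : ℕ} (hm : 0 < m) {S : Finset ℕ}
    (hS : S ⊆ Finset.range m) (hN : m + 1 < N) (hL : N ≤ L) :
    zeroCount (cosPoly (S ∪ Finset.Ico (m + 1) N)) ≤
      ((2 * (((Finset.range (2 * L)).filter fun j : ℕ =>
        |lowFrequencyPart m S (j * (Real.pi / L))| ≤ 1).card + 2 * (2 * m + 1))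
          + (2 * m + 1) : ℕ) : ℕ∞) := by
  classical
  obtain ⟨k, rfl⟩ : ∃ k, m = k + 1 := ⟨m - 1, by omega⟩
  set m := k + 1 with hmk
  have hSk : ∀ a ∈ S, a ≤ k := fun a ha => by have := Finset.mem_range.mp (hS ha); omega
  set A := S ∪ Finset.Ico (m + 1) N with hA
  have hAne : A.Nonempty := ⟨m + 1, Finset.mem_union_right _ (Finset.mem_Ico.mpr ⟨le_rfl, hN⟩)⟩
  set M : ℝ := N - 1 / 2 with hM
  have hN' : (m : ℝ) + 1 < N := by exact_mod_cast hN
  have hm0 : (0 : ℝ) ≤ m := by positivity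
  set T := lowFrequencyPart m S with hT
  set U : ℝ → ℝ := fun x => 2 * Real.sin (x / 2) * cosPoly S x with hU
  set F : ℝ → ℝ := fun x => Real.sin (M * x) + T x with hF
  have hFA : F = (fun x => 2 * Real.sin (x / 2)) * cosPoly A := by
    funext x
    have hdisj : Disjoint S (Finset.Ico (m + 1) N) := by
      rw [Finset.disjoint_left]
      intro a ha hb
      have := hSk a ha
      have := (Finset.mem_Ico.mp hb).1
      omega
    have h1 : cosPoly A x = cosPoly S x + cosPoly (Finset.Ico (m + 1) N) x := by
      rw [hA, cosPoly, Finset.sum_union hdisj]; rfl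
    rw [Pi.mul_apply, h1, mul_add, two_mul_sin_half_mul_cosPoly_Ico hN.le]
    simp only [hF, hT, lowFrequencyPart, hM]
    rw [show (((m + 1 : ℕ) : ℝ) - 1 / 2) * x = ((2 * m + 1 : ℕ) : ℝ) * (x / 2) by push_cast; ring]
    ring
  have ahalf : ∀ x : ℝ, AnalyticAt ℝ (fun x => 2 * Real.sin (x / 2)) x := fun x => by fun_prop
  have aU : ∀ x, AnalyticAt ℝ U x := fun x => (ahalf x).mul (analyticAt_cosPoly S x)
  have aT : ∀ x, AnalyticAt ℝ T x := fun x => by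
    have : AnalyticAt ℝ (fun x : ℝ => Real.sin ((2 * m + 1 : ℕ) * (x / 2))) x := by fun_prop
    exact (aU x).sub this
  set c : ℝ := m + 1 / 2 with hc
  have hTU : ∀ x, T x = U x - Real.sin (c * x) := fun x => by
    simp only [hT, hU, lowFrequencyPart, hc]
    congr 2; push_cast; ring
  have dsin : ∀ c x : ℝ, HasDerivAt (fun x => Real.sin (c * x)) (c * Real.cos (c * x)) x :=
    fun c x => (((hasDerivAt_id x).const_mul c).sin).congr_deriv (by simp; ring)
  have dcos : ∀ c x : ℝ, HasDerivAt (fun x => c * Real.cos (c * x))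
      (-(c ^ 2 * Real.sin (c * x))) x :=
    fun c x => ((((hasDerivAt_id x).const_mul c).cos).const_mul c).congr_deriv (by simp; ring)
  have dU : ∀ x, HasDerivAt U (deriv U x) x := fun x => (aU x).differentiableAt.hasDerivAt
  have dU' : ∀ x, HasDerivAt (deriv U) (deriv (deriv U) x) x :=
    fun x => (aU x).deriv.differentiableAt.hasDerivAt
  have hF' : deriv F = fun x => M * Real.cos (M * x) + (deriv U x - c * Real.cos (c * x)) := by
    funext x
    have : F = fun x => Real.sin (M * x) + (U x - Real.sin (c * x)) :=
      funext fun x => by rw [hF, ← hTU]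
    rw [this]
    exact ((dsin M x).add ((dU x).sub (dsin c x))).deriv
  have hF'' : ∀ x, deriv (deriv F) x + M ^ 2 * F x
      = (deriv (deriv U) x + M ^ 2 * U x) - (M ^ 2 - c ^ 2) * Real.sin (c * x) := by
    intro x
    have h := ((dcos M x).add ((dU' x).sub (dcos c x))).deriv
    have h' : deriv (deriv F) x = -(M ^ 2 * Real.sin (M * x)) +
        (deriv (deriv U) x - -(c ^ 2 * Real.sin (c * x))) := by rw [hF']; exact h
    rw [h']
    simp only [hF, hTU]
    ring
  have tU : IsTrigPoly (2 * k + 1) U := isTrigPoly_two_mul_sin_half_mul_cosPoly hSk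
  have tU' : IsTrigPoly (2 * k + 1) fun x => deriv (deriv U) x + M ^ 2 * U x :=
    ((tU.deriv_of_hasDerivAt dU).deriv_of_hasDerivAt dU').add (tU.const_mul _)
  have hcx : ∀ x : ℝ, c * x = ((2 * k + 1 + 2 : ℕ) : ℝ) * (x / 2) := fun x => by
    rw [hc, hmk]; push_cast; ring
  have tsin : IsTrigPoly (2 * m + 1) fun x => Real.sin (c * x) := by
    have := IsTrigPoly.sin_mul (2 * k + 1 + 2)
    simp only [← hcx] at this
    rwa [show 2 * k + 1 + 2 = 2 * m + 1 by omega] at this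
  have up : ∀ {f : ℝ → ℝ}, IsTrigPoly (2 * k + 1) f → IsTrigPoly (2 * m + 1) f := fun hf => by
    have := hf.add_two_mul 1
    rwa [show 2 * k + 1 + 2 * 1 = 2 * m + 1 by omega] at this
  have tW : IsTrigPoly (2 * m + 1) fun x => deriv (deriv F) x + M ^ 2 * F x := by
    simp only [hF'']
    exact (up tU').sub (tsin.const_mul _)
  have hMc : M ^ 2 - c ^ 2 ≠ 0 := by
    have : c < M := by rw [hc, hM]; linarith
    have hc0 : 0 < c := by positivity
    nlinarith
  -- If this vanished identically, `sin (c x)` would be a multiple of `U'' + M² U`, whose degree is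
  -- smaller by two.
  have hW0 : ∃ x, deriv (deriv F) x + M ^ 2 * F x ≠ 0 := by
    by_contra! h
    apply IsTrigPoly.not_sin_mul (2 * k + 1)
    have h1 := tU'.const_mul (M ^ 2 - c ^ 2)⁻¹
    convert h1 using 2 with x
    have h2 := h x
    rw [hF'', sub_eq_zero] at h2
    rw [h2, inv_mul_cancel_left₀ hMc, hcx]
  have tT : IsTrigPoly (2 * (2 * m + 1)) fun x => T x ^ 2 - 1 := by
    have h1 : IsTrigPoly (2 * m + 1) T := by
      rw [show T = fun x => U x - Real.sin (c * x) from funext hTU]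
      exact (up tU).sub tsin
    have h2 := h1.mul h1
    have h3 := (IsTrigPoly.const 1).add_two_mul (2 * m + 1)
    rw [zero_add] at h3
    rw [← two_mul] at h2
    simpa only [sq] using h2.sub h3
  refine zeroCount_le_of_forall fun Z hZ => ?_
  have hZ' : (Z : Set ℝ) ⊆ Set.Ioo 0 (2 * Real.pi) := hZ.trans (zeroSet_cosPoly_subset hAne)
  refine le_trans (Finset.sum_le_sum fun x hx => ?_)
    (sum_order_le_of_grid (F := F) (T := T) (M := M) (L := L) (by linarith) ?_ (fun _ => rfl) aT
      tW hW0 tT ⟨0, ?_⟩ Z (hZ'.trans Set.Ioo_subset_Ico_self))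
  -- The factor `2 sin (x / 2)` can only increase the order.
  · rw [hFA, analyticOrderAt_mul (ahalf x) (analyticAt_cosPoly A x)]
    exact le_add_self
  · have : (N : ℝ) ≤ L := by exact_mod_cast hL
    linarith
  · simp [hT, lowFrequencyPart]

/-! ### Averaging over the low block. -/

/-- Dividing by `2 sin (x / 2)` confines `f_S(x)` to an interval of length `1 / sin (x / 2) ≥ 1`. -/
theorem card_lowFrequencyPart_le {m : ℕ} (hm : 0 < m) {x : ℝ} (hx : 0 < Real.sin (x / 2)) :
    (((Finset.range m).powerset.filter fun S => |lowFrequencyPart m S x| ≤ 1).card : ℝ)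
      ≤ 6 * (1 / Real.sin (x / 2)) * 2 ^ m / Real.sqrt m := by
  set s := Real.sin (x / 2) with hs
  set b := Real.sin ((2 * m + 1 : ℕ) * (x / 2)) with hb
  refine le_trans ?_ (card_cosSum_mem_Icc_le hm x ((b - 1) / (2 * s)) (l := 1 / s)
    ((one_le_div hx).mpr (Real.sin_le_one _)))
  norm_cast
  refine Finset.card_le_card fun S hS => ?_
  simp only [Finset.mem_filter] at hS ⊢
  refine ⟨hS.1, ?_⟩
  have h := abs_le.mp hS.2
  rw [lowFrequencyPart, ← hs, ← hb] at h
  change cosPoly S x ∈ _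
  rw [show (b - 1) / (2 * s) + 1 / s = (b + 1) / (2 * s) by field_simp; ring]
  constructor
  · rw [div_le_iff₀ (by linarith)]; linarith [h.1]
  · rw [le_div_iff₀ (by linarith)]; linarith [h.2]

/-- Jordan's inequality `sin t ≥ 2 t / π` on `[0, π / 2]`, reflected for the second half of the
grid. -/
theorem one_div_sin_grid_le {L j : ℕ} (hj : 0 < j) (hjL : j < 2 * L) :
    0 < Real.sin (j * (Real.pi / L) / 2) ∧
    1 / Real.sin (j * (Real.pi / L) / 2) ≤ L * ((j : ℝ)⁻¹ + ((2 * L - j : ℝ))⁻¹) := by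
  have hL : (0 : ℝ) < L := by exact_mod_cast (by omega : 0 < L)
  have hj' : (0 : ℝ) < j := by exact_mod_cast hj
  have hj2 : (0 : ℝ) < 2 * L - j := by
    have : (j : ℝ) < 2 * L := by exact_mod_cast hjL
    linarith
  have hp := Real.pi_pos
  have key : ∀ t : ℝ, 0 < t → t ≤ L → 0 < Real.sin (t * (Real.pi / L) / 2) ∧
      1 / Real.sin (t * (Real.pi / L) / 2) ≤ L * t⁻¹ := by
    intro t ht htL
    have h := Real.mul_le_sin (x := t * (Real.pi / L) / 2) (by positivity) (by
      have : t * (Real.pi / L) ≤ L * (Real.pi / L) := by gcongr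
      rw [mul_div_cancel₀ _ hL.ne'] at this
      linarith)
    have e : 2 / Real.pi * (t * (Real.pi / L) / 2) = t / L := by field_simp
    rw [e] at h
    have h0 : 0 < t / L := by positivity
    refine ⟨h0.trans_le h, (one_div_le_one_div_of_le h0 h).trans (le_of_eq ?_)⟩
    field_simp
  rcases le_total (j : ℝ) L with h | h
  · obtain ⟨h1, h2⟩ := key j hj' h
    refine ⟨h1, h2.trans ?_⟩
    gcongr
    exact le_add_of_nonneg_right (by positivity)
  · obtain ⟨h1, h2⟩ := key (2 * L - j) hj2 (by linarith)
    have e : (2 * L - j : ℝ) * (Real.pi / L) / 2 = Real.pi - j * (Real.pi / L) / 2 := by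
      field_simp
    rw [e, Real.sin_pi_sub] at h1 h2
    refine ⟨h1, h2.trans ?_⟩
    gcongr
    exact le_add_of_nonneg_left (by positivity)

theorem sum_inv_add_inv_le {L : ℕ} (hL : 0 < L) :
    ∑ i ∈ Finset.range (2 * L - 1), (((i + 1 : ℕ) : ℝ)⁻¹ + ((2 * L - (i + 1 : ℕ) : ℝ))⁻¹)
      ≤ 2 * (1 + Real.log (2 * L)) := by
  have h1 : ∑ i ∈ Finset.range (2 * L - 1), (((i + 1 : ℕ) : ℝ))⁻¹ ≤ 1 + Real.log (2 * L) := by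
    have h := harmonic_le_one_add_log (2 * L - 1)
    have h2 : ((harmonic (2 * L - 1) : ℚ) : ℝ)
        = ∑ i ∈ Finset.range (2 * L - 1), (((i + 1 : ℕ) : ℝ))⁻¹ := by
      rw [harmonic]; push_cast; rfl
    rw [← h2]
    refine h.trans ?_
    have h3 : ((2 * L - 1 : ℕ) : ℝ) ≤ 2 * L := by exact_mod_cast Nat.sub_le _ _
    have h4 : (0 : ℝ) < ((2 * L - 1 : ℕ) : ℝ) := by exact_mod_cast (by omega : 0 < 2 * L - 1)
    gcongr
  have h2 : ∑ i ∈ Finset.range (2 * L - 1), ((2 * L - (i + 1 : ℕ) : ℝ))⁻¹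
      = ∑ i ∈ Finset.range (2 * L - 1), (((i + 1 : ℕ) : ℝ))⁻¹ := by
    rw [← Finset.sum_range_reflect]
    refine Finset.sum_congr rfl fun i hi => ?_
    rw [Finset.mem_range] at hi
    congr 1
    have : 2 * L - 1 - 1 - i + 1 + (i + 1) = 2 * L := by omega
    have : (((2 * L - 1 - 1 - i + 1 : ℕ) : ℝ)) + ((i + 1 : ℕ) : ℝ) = 2 * L := by exact_mod_cast this
    linarith
  rw [Finset.sum_add_distrib, h2]
  linarith

/-- Averaging over `S` gives a set whose low frequency part is rarely small on the grid. -/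
theorem exists_card_lowFrequencyPart_le {m L : ℕ} (hm : 0 < m) (hL : 0 < L) :
    ∃ S ⊆ Finset.range m,
      (((Finset.range (2 * L)).filter fun j : ℕ =>
        |lowFrequencyPart m S (j * (Real.pi / L))| ≤ 1).card : ℝ)
      ≤ 1 + 12 * L * (1 + Real.log (2 * L)) / Real.sqrt m := by
  classical
  set B : ℝ := 1 + 12 * L * (1 + Real.log (2 * L)) / Real.sqrt m with hB
  have hcard : ((Finset.range m).powerset.card : ℝ) = 2 ^ m := by simp
  have hsum : ∑ S ∈ (Finset.range m).powerset, (((Finset.range (2 * L)).filter fun j : ℕ =>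
        |lowFrequencyPart m S (j * (Real.pi / L))| ≤ 1).card : ℝ)
      ≤ ∑ _S ∈ (Finset.range m).powerset, B := by
    have hswap : ∑ S ∈ (Finset.range m).powerset, (((Finset.range (2 * L)).filter fun j : ℕ =>
        |lowFrequencyPart m S (j * (Real.pi / L))| ≤ 1).card : ℝ)
        = ∑ j ∈ Finset.range (2 * L), (((Finset.range m).powerset.filter fun S =>
            |lowFrequencyPart m S (j * (Real.pi / L))| ≤ 1).card : ℝ) := by
      simp only [Finset.card_filter]
      push_cast
      exact Finset.sum_comm
    -- The grid point `0` is split off: `T` vanishes there for every `S`, which accounts for the `1`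
    -- in `B`.
    rw [hswap, show 2 * L = 2 * L - 1 + 1 by omega, Finset.sum_range_succ', Finset.sum_const,
      nsmul_eq_mul, hcard]
    have h0 : (((Finset.range m).powerset.filter fun S =>
        |lowFrequencyPart m S ((0 : ℕ) * (Real.pi / L))| ≤ 1).card : ℝ) ≤ 2 ^ m := by
      rw [← hcard]
      exact_mod_cast Finset.card_filter_le _ _
    have hs : 0 < Real.sqrt m := Real.sqrt_pos.mpr (by exact_mod_cast hm)
    have h1 : ∑ i ∈ Finset.range (2 * L - 1), (((Finset.range m).powerset.filter fun S =>
        |lowFrequencyPart m S ((i + 1 : ℕ) * (Real.pi / L))| ≤ 1).card : ℝ)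
        ≤ ∑ i ∈ Finset.range (2 * L - 1), (6 * L * 2 ^ m / Real.sqrt m) *
          (((i + 1 : ℕ) : ℝ)⁻¹ + ((2 * L - (i + 1 : ℕ) : ℝ))⁻¹) := by
      refine Finset.sum_le_sum fun i hi => ?_
      rw [Finset.mem_range] at hi
      obtain ⟨hp, hle⟩ := one_div_sin_grid_le (L := L) (j := i + 1) (by omega) (by omega)
      refine (card_lowFrequencyPart_le hm hp).trans ?_
      calc _ ≤ 6 * (L * ((((i + 1 : ℕ) : ℝ))⁻¹ + ((2 * L - (i + 1 : ℕ) : ℝ))⁻¹)) * 2 ^ m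
              / Real.sqrt m := by gcongr
        _ = _ := by ring
    rw [← Finset.mul_sum] at h1
    have h2 := mul_le_mul_of_nonneg_left (sum_inv_add_inv_le hL)
      (by positivity : 0 ≤ 6 * (L : ℝ) * 2 ^ m / Real.sqrt m)
    have h3 : (2 : ℝ) ^ m * B = 6 * (L : ℝ) * 2 ^ m / Real.sqrt m * (2 * (1 + Real.log (2 * L)))
        + 2 ^ m := by
      rw [hB]; ring
    rw [h3]
    exact add_le_add (h1.trans h2) h0
  obtain ⟨S, hS, h⟩ := Finset.exists_le_of_sum_le ⟨∅, by simp⟩ hsum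
  exact ⟨S, Finset.mem_powerset.mp hS, h⟩

/-! ### Choice of parameters. -/

theorem exists_card_eq_zeroCount_le {n m : ℕ} (hm : 0 < m) (hmn : m < n) :
    ∃ A : Finset ℕ, A.card = n ∧ ∃ Z : ℕ, zeroCount (cosPoly A) = (Z : ℕ∞) ∧
      (Z : ℝ) ≤ 17 * m + 48 * n * (1 + Real.log (4 * n)) / Real.sqrt m := by
  classical
  -- The grid must be fixed before `S` is chosen. This `L` is at least `N = L - |S|` for every `S`,
  -- and that `N` makes `|A| = |S| + (N - m - 1) = n`.
  set L := n + m + 1 with hL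
  obtain ⟨S, hS, hbad⟩ := exists_card_lowFrequencyPart_le (m := m) (L := L) hm (by omega)
  have hSc : S.card ≤ m := by simpa using Finset.card_le_card hS
  set N := L - S.card with hN
  have hz := zeroCount_cosPoly_union_le hm hS (N := N) (L := L) (by omega) (by omega)
  refine ⟨S ∪ Finset.Ico (m + 1) N, ?_, ?_⟩
  · rw [Finset.card_union_of_disjoint, Nat.card_Ico]
    · omega
    · rw [Finset.disjoint_left]
      intro a ha hb
      have := Finset.mem_range.mp (hS ha)
      have := (Finset.mem_Ico.mp hb).1
      omega
  · obtain ⟨Z, hZ⟩ := ENat.ne_top_iff_exists.mp (ne_top_of_le_ne_top (ENat.natCast_ne_top _) hz)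
    refine ⟨Z, hZ.symm, ?_⟩
    rw [← hZ, Nat.cast_le] at hz
    have hz' : (Z : ℝ) ≤ _ := Nat.cast_le.mpr hz
    push_cast at hz'
    have hL2 : (L : ℝ) ≤ 2 * n := by exact_mod_cast (by omega : L ≤ 2 * n)
    have hL0 : (0 : ℝ) < L := by exact_mod_cast (by omega : 0 < L)
    have hn1 : (1 : ℝ) ≤ 2 * L := by exact_mod_cast (by omega : 1 ≤ 2 * L)
    have hlog : Real.log (2 * L) ≤ Real.log (4 * n) := by
      apply Real.log_le_log (by positivity); linarith
    have hlog0 := Real.log_nonneg hn1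
    have hs : 0 < Real.sqrt m := Real.sqrt_pos.mpr (by exact_mod_cast hm)
    have h1 : 12 * L * (1 + Real.log (2 * L)) / Real.sqrt m
        ≤ 12 * (2 * n) * (1 + Real.log (4 * n)) / Real.sqrt m := by gcongr
    have h2 : 48 * n * (1 + Real.log (4 * n)) / Real.sqrt m
        = 2 * (12 * (2 * n) * (1 + Real.log (4 * n)) / Real.sqrt m) := by ring
    have hm1 : (1 : ℝ) ≤ m := by exact_mod_cast hm
    -- Besides the logarithmic term the bound is `10 m + 7`, at most `17 m` as `m ≥ 1`.
    linarith

theorem theorem1 :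
    ∃ C : ℝ, 0 < C ∧ ∀ n : ℕ, 1 ≤ n →
      ∃ A : Finset ℕ, A.card = n ∧
        ∃ Z : ℕ, zeroCount (cosPoly A) = (Z : ℕ∞) ∧
          (Z : ℝ) ≤ C * ((n : ℝ) * Real.log (n : ℝ)) ^ ((2 : ℝ) / 3) := by
  refine ⟨600, by norm_num, fun n hn => ?_⟩
  have trivial_bound : ∃ Z : ℕ, zeroCount (cosPoly (Finset.range n)) = (Z : ℕ∞) ∧
      Z ≤ 2 * (n - 1) := by
    have hz := zeroCount_cosPoly_le (A := Finset.range n) (k := n - 1)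
      (Finset.nonempty_range_iff.mpr (by omega))
      fun a ha => by have := Finset.mem_range.mp ha; omega
    obtain ⟨Z, hZ⟩ := ENat.ne_top_iff_exists.mp (ne_top_of_le_ne_top (ENat.natCast_ne_top _) hz)
    rw [← hZ, Nat.cast_le] at hz
    exact ⟨Z, hZ.symm, hz⟩
  -- For `n = 1` the right-hand side is `0`, so there must be no zeros at all; `A = {0}` gives the
  -- constant `1`.
  rcases hn.eq_or_lt with rfl | hn2
  · obtain ⟨Z, hZ, hle⟩ := trivial_bound
    refine ⟨Finset.range 1, by simp, Z, hZ, ?_⟩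
    have : Z = 0 := by omega
    rw [this]
    simp
  have hn2' : (2 : ℝ) ≤ n := by exact_mod_cast hn2
  have hlog2 : 1 / 2 < Real.log 2 := by linarith [Real.log_two_gt_d9]
  have hlogn : Real.log 2 ≤ Real.log n := Real.log_le_log (by norm_num) hn2'
  set y : ℝ := n * Real.log n with hy
  set x : ℝ := y ^ ((2 : ℝ) / 3) with hx
  have hy1 : 1 ≤ y := by nlinarith
  have hx1 : 1 ≤ x := Real.one_le_rpow hy1 (by norm_num)
  have hxy : x * Real.sqrt x = y := by
    rw [Real.sqrt_eq_rpow, hx, ← Real.rpow_mul (by linarith), ← Real.rpow_add (by linarith)]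
    norm_num
  set m := ⌊x⌋₊ with hm
  have hm1 : 1 ≤ m := Nat.one_le_floor_iff x |>.mpr hx1
  have hmx : (m : ℝ) ≤ x := Nat.floor_le (by linarith)
  have hxm : x < m + 1 := Nat.lt_floor_add_one x
  rcases lt_or_ge m n with hmn | hmn
  · obtain ⟨A, hA, Z, hZ, hle⟩ := exists_card_eq_zeroCount_le hm1 hmn
    refine ⟨A, hA, Z, hZ, hle.trans ?_⟩
    have hm1' : (1 : ℝ) ≤ m := by exact_mod_cast hm1
    have hlog4 : 1 + Real.log (4 * n) ≤ 5 * Real.log n := by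
      rw [Real.log_mul (by norm_num) (by positivity),
        show (4 : ℝ) = 2 ^ 2 by norm_num, Real.log_pow]
      push_cast
      linarith
    have hsx : 0 < Real.sqrt x := Real.sqrt_pos.mpr (by linarith)
    -- Since `x < m + 1 ≤ 4 m`.
    have hsm : Real.sqrt x ≤ 2 * Real.sqrt m := by
      rw [Real.sqrt_le_left (by positivity), mul_pow, Real.sq_sqrt (by positivity)]
      linarith
    have h1 : 48 * n * (1 + Real.log (4 * n)) / Real.sqrt m ≤ 480 * x := by
      calc 48 * n * (1 + Real.log (4 * n)) / Real.sqrt m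
          ≤ 48 * n * (5 * Real.log n) / (Real.sqrt x / 2) := by
            gcongr
            · linarith
        _ = 480 * y / Real.sqrt x := by rw [hy]; field_simp; ring
        _ = 480 * x := by rw [← hxy]; field_simp
    linarith
  -- When `x ≥ m ≥ n`, the degree bound `2 (n - 1)` is already good enough.
  · obtain ⟨Z, hZ, hle⟩ := trivial_bound
    refine ⟨Finset.range n, by simp, Z, hZ, ?_⟩
    have h1 : (Z : ℝ) ≤ 2 * m := by exact_mod_cast (by omega : Z ≤ 2 * m)
    linarith
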